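/- For positive integers $q,n$ let $$c_q(n)=\mu\!\left(\frac{q}{\gcd(q,n)}\right)\frac{\varphi(q)}{\varphi\!\left(q/\gcd(q,n)\right)}$$ be the Ramanujan sum, where $\mu$ is the Möbius function and $\varphi$ is Euler's totient function. Then the infinite product $\prod_{p}\left(1-\frac{3}{p^2}+\frac{2}{p^3}\right)$ over all primes $p$ converges (unconditionally), and, with $x$ ranging over the real numbers and $q,n$ over the positive integers, $$\lim_{x\to\infty}\frac{1}{x^2\log x}\sum_{q\le x}\ \sum_{n\le x}|c_q(n)|=\prod_{p}\left(1-\frac{3}{p^2}+\frac{2}{p^3}\right).$$ -/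

import Mathlib

open Filter Topology

/-- The Ramanujan sum `c_q(n) = μ(q / (q, n)) φ(q) / φ(q / (q, n))`, for positive integers
`q` and `n`, where `(q, n)` is the greatest common divisor. The quotient `q / (q, n)` is an
exact division of natural numbers; the outer division takes place in `ℝ`. -/
noncomputable def ramanujanSum (q n : ℕ) : ℝ :=
  (ArithmeticFunction.moebius (q / Nat.gcd q n) : ℝ) * (Nat.totient q : ℝ) /
    (Nat.totient (q / Nat.gcd q n) : ℝ)

/-! Put `e = q / gcd(q, n)`. Then `|c_q(n)|` is `φ(q) / φ(e)` for squarefree `e` and 0 otherwise.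
Let `T` be a random set of primes of `q`, each `p` taken independently with probability `1 / (p -
1)`. For squarefree `e`, `1 / φ(e)` is the probability that `T` contains every prime of `e`, so
`|c_q(n)|` is `φ(q)` times the probability that `q ∣ n ∏ T` (`abs_ramanujanSum_eq_sum`). Summing
over `n ≤ N` gives `N 2 ^ ω(q) φ(q) / q` up to `φ(q)` (`abs_sum_abs_ramanujanSum_sub_le`), a total
error of at most `N ^ 2`. The mean `2 ^ ω(q) φ(q) / q` is `g * d`, with `d` the divisor function and
`∑ |g(m)| / m` finite. Since `∑_{n ≤ M} d(n) ~ M log M`, dominated convergence gives the constant `∑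
g(m) / m`, whose Euler product is the stated one (`hasProd_meanCoeff`). -/

/-! ### Random subsets of primes and the expansion of `|c_q(n)|`. -/

/-- The nonnegative weights in the expansion of `|ramanujanSum q n|` over subsets of the set of
prime factors of `q`. -/
noncomputable def subsetWeight (P T : Finset ℕ) : ℝ :=
  (∏ p ∈ T, 1 / ((p : ℝ) - 1)) * ∏ p ∈ P \ T, ((p : ℝ) - 2) / ((p : ℝ) - 1)

lemma subsetWeight_nonneg {P T : Finset ℕ} (hP : ∀ p ∈ P, p.Prime) (hT : T ⊆ P) :
    0 ≤ subsetWeight P T := by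
  refine mul_nonneg (Finset.prod_nonneg fun p hp => ?_) (Finset.prod_nonneg fun p hp => ?_)
  · have : (2 : ℝ) ≤ p := mod_cast (hP p (hT hp)).two_le
    exact div_nonneg one_pos.le (by linarith)
  · have : (2 : ℝ) ≤ p := mod_cast (hP p (Finset.mem_sdiff.1 hp).1).two_le
    exact div_nonneg (by linarith) (by linarith)

lemma sum_subsetWeight_superset {P E : Finset ℕ} (hP : ∀ p ∈ P, p.Prime) (hE : E ⊆ P) :
    ∑ T ∈ P.powerset, subsetWeight P T * (if E ⊆ T then 1 else 0) =
      ∏ p ∈ E, 1 / ((p : ℝ) - 1) := by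
  -- Replacing the exclusion factor by 0 on `E` kills exactly the subsets that miss a prime of `E`.
  have key := Finset.prod_add (fun p : ℕ => 1 / ((p : ℝ) - 1))
    (fun p : ℕ => if p ∈ E then 0 else ((p : ℝ) - 2) / ((p : ℝ) - 1)) P
  have hl : ∏ p ∈ P, (1 / ((p : ℝ) - 1) + if p ∈ E then 0 else ((p : ℝ) - 2) / ((p : ℝ) - 1)) =
      ∏ p ∈ E, 1 / ((p : ℝ) - 1) := by
    rw [← Finset.prod_subset hE]
    · exact Finset.prod_congr rfl fun p hp => by simp [hp]
    · intro p hp hpE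
      have : (2 : ℝ) ≤ p := mod_cast (hP p hp).two_le
      have : (p : ℝ) - 1 ≠ 0 := by linarith
      simp only [hpE, if_false]
      field_simp
      ring
  rw [← hl, key]
  refine Finset.sum_congr rfl fun T _ => ?_
  rw [subsetWeight, mul_assoc]
  congr 1
  split_ifs with h
  · rw [mul_one]
    refine Finset.prod_congr rfl fun p hp => ?_
    rw [if_neg fun hpE => (Finset.mem_sdiff.1 hp).2 (h hpE)]
  · obtain ⟨p, hpE, hpT⟩ := Finset.not_subset.1 h
    rw [mul_zero, Finset.prod_eq_zero (Finset.mem_sdiff.2 ⟨hE hpE, hpT⟩)]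
    simp [hpE]

lemma sum_subsetWeight {P : Finset ℕ} (hP : ∀ p ∈ P, p.Prime) :
    ∑ T ∈ P.powerset, subsetWeight P T = 1 := by
  simpa using sum_subsetWeight_superset hP (Finset.empty_subset P)

/-- By independence each prime contributes `p / (p - 1) + (p - 2) / (p - 1) = 2`; this produces the
main term. -/
lemma sum_subsetWeight_mul_prod {P : Finset ℕ} (hP : ∀ p ∈ P, p.Prime) :
    ∑ T ∈ P.powerset, subsetWeight P T * ∏ p ∈ T, (p : ℝ) = 2 ^ P.card := by
  have key := Finset.prod_add (fun p : ℕ => 1 / ((p : ℝ) - 1) * p)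
    (fun p : ℕ => ((p : ℝ) - 2) / ((p : ℝ) - 1)) P
  have hl : ∏ p ∈ P, (1 / ((p : ℝ) - 1) * p + ((p : ℝ) - 2) / ((p : ℝ) - 1)) = 2 ^ P.card := by
    rw [← Finset.prod_const]
    refine Finset.prod_congr rfl fun p hp => ?_
    have : (2 : ℝ) ≤ p := mod_cast (hP p hp).two_le
    have : (p : ℝ) - 1 ≠ 0 := by linarith
    field_simp
    ring
  rw [← hl, key]
  refine Finset.sum_congr rfl fun T _ => ?_
  rw [subsetWeight, Finset.prod_mul_distrib]
  ring

lemma dvd_mul_iff_div_gcd_dvd {q n t : ℕ} (hq : q ≠ 0) : q ∣ n * t ↔ q / q.gcd n ∣ t := by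
  have hg : 0 < q.gcd n := Nat.gcd_pos_of_pos_left _ (Nat.pos_of_ne_zero hq)
  have hc : Nat.Coprime (q / q.gcd n) (n / q.gcd n) := Nat.coprime_div_gcd_div_gcd hg
  have h1 : q = q.gcd n * (q / q.gcd n) := (Nat.mul_div_cancel' (Nat.gcd_dvd_left q n)).symm
  have h2 : n = q.gcd n * (n / q.gcd n) := (Nat.mul_div_cancel' (Nat.gcd_dvd_right q n)).symm
  have h3 : n * t = q.gcd n * (n / q.gcd n * t) := by rw [← mul_assoc, ← h2]
  have h4 := Nat.mul_dvd_mul_iff_left (b := q / q.gcd n) (c := n / q.gcd n * t) hg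
  rw [← h1, ← h3] at h4
  rw [h4, hc.dvd_mul_left]

lemma totient_of_squarefree {e : ℕ} (he : Squarefree e) :
    (e.totient : ℝ) = ∏ p ∈ e.primeFactors, ((p : ℝ) - 1) := by
  rw [Nat.totient_eq_div_primeFactors_mul, Nat.prod_primeFactors_of_squarefree he,
    Nat.div_self he.ne_zero.bot_lt, one_mul, Nat.cast_prod]
  exact Finset.prod_congr rfl fun p hp => by
    rw [Nat.cast_sub (Nat.prime_of_mem_primeFactors hp).one_le, Nat.cast_one]

lemma squarefree_prod_primes {T : Finset ℕ} (hT : ∀ p ∈ T, p.Prime) :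
    Squarefree (∏ p ∈ T, p) := by
  refine Finset.squarefree_prod_of_pairwise_isCoprime (fun p hp r hr hne => ?_)
    fun p hp => (hT p hp).prime.squarefree
  exact Nat.coprime_iff_isRelPrime.1 ((Nat.coprime_primes (hT p hp) (hT r hr)).2 hne)

lemma abs_ramanujanSum_eq_sum {q : ℕ} (hq : q ≠ 0) (n : ℕ) :
    |ramanujanSum q n| = q.totient * ∑ T ∈ q.primeFactors.powerset,
      subsetWeight q.primeFactors T * (if q ∣ n * ∏ p ∈ T, p then 1 else 0) := by
  have hP : ∀ p ∈ q.primeFactors, p.Prime := fun p hp => Nat.prime_of_mem_primeFactors hp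
  simp only [dvd_mul_iff_div_gcd_dvd hq]
  rw [ramanujanSum, abs_div, abs_mul, Nat.abs_cast, Nat.abs_cast, mul_comm |_|, mul_div_assoc]
  congr 1
  have hE0 : q / q.gcd n ∣ q := Nat.div_dvd_of_dvd (Nat.gcd_dvd_left q n)
  generalize q / q.gcd n = e at *
  by_cases he : Squarefree e
  · rw [← Int.cast_abs, ArithmeticFunction.abs_moebius_eq_one_of_squarefree he,
      totient_of_squarefree he, Int.cast_one, one_div,
      ← Finset.prod_inv_distrib]
    have := sum_subsetWeight_superset hP (Nat.primeFactors_mono hE0 hq)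
    simp only [one_div] at this
    rw [← this]
    refine Finset.sum_congr rfl fun T hT => ?_
    have hT' : ∀ p ∈ T, p.Prime := fun p hp => hP p (Finset.mem_powerset.1 hT hp)
    have h0 : ∏ p ∈ T, p ≠ 0 := Finset.prod_ne_zero_iff.2 fun p hp => (hT' p hp).ne_zero
    have : e ∣ ∏ p ∈ T, p ↔ e.primeFactors ⊆ T := by
      conv_lhs => rw [← Nat.prod_primeFactors_of_squarefree he]
      rw [Nat.prod_primeFactors_dvd_iff h0, Nat.primeFactors_prod hT']
    simp only [this]
  -- A product of distinct primes has no non-squarefree divisor, which matches `μ(e) = 0`.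
  · rw [ArithmeticFunction.moebius_eq_zero_of_not_squarefree he, Int.cast_zero, abs_zero, zero_div,
      Finset.sum_eq_zero fun T hT => ?_]
    have hT' : ∀ p ∈ T, p.Prime := fun p hp => hP p (Finset.mem_powerset.1 hT hp)
    rw [if_neg fun h => he ((squarefree_prod_primes hT').squarefree_of_dvd h), mul_zero]

/-! ### Summation over `n`. -/

/-- `2 ^ ω(q) φ(q) / q`, the mean value of `|c_q(n)|` over `n`. -/
noncomputable def meanAbsRamanujan : ArithmeticFunction ℝ where
  toFun q := 2 ^ q.primeFactors.card * (q.totient : ℝ) / q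
  map_zero' := by simp

lemma meanAbsRamanujan_apply (q : ℕ) :
    meanAbsRamanujan q = 2 ^ q.primeFactors.card * (q.totient : ℝ) / q := rfl

lemma sum_dvd_mul_indicator {q t : ℕ} (htq : t ∣ q) (hq : q ≠ 0) (N : ℕ) :
    ∑ n ∈ Finset.Icc 1 N, (if q ∣ n * t then (1 : ℝ) else 0) = (N / (q / t) : ℕ) := by
  obtain ⟨d, rfl⟩ := htq
  have ht : 0 < t := Nat.pos_of_ne_zero (left_ne_zero_of_mul hq)
  rw [Nat.mul_div_cancel_left _ ht, ← Nat.Ioc_filter_dvd_card_eq_div, Finset.sum_boole]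
  simp only [mul_comm _ t, Nat.mul_dvd_mul_iff_left ht]
  rfl

/-- Each floor costs at most 1 and the weights are nonnegative of total 1. An error of `2 ^ ω(q)
φ(q)` would add up to the order of the main term. -/
lemma abs_sum_abs_ramanujanSum_sub_le {q : ℕ} (hq : q ≠ 0) (N : ℕ) :
    |∑ n ∈ Finset.Icc 1 N, |ramanujanSum q n| - N * meanAbsRamanujan q| ≤ q.totient := by
  have hP : ∀ p ∈ q.primeFactors, p.Prime := fun p hp => Nat.prime_of_mem_primeFactors hp
  have hq' : (q : ℝ) ≠ 0 := mod_cast hq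
  have e1 : ∑ n ∈ Finset.Icc 1 N, |ramanujanSum q n| = q.totient *
      ∑ T ∈ q.primeFactors.powerset, subsetWeight q.primeFactors T *
        ((N / (q / ∏ p ∈ T, p) : ℕ) : ℝ) := by
    simp only [abs_ramanujanSum_eq_sum hq]
    rw [← Finset.mul_sum, Finset.sum_comm]
    congr 1
    refine Finset.sum_congr rfl fun T hT => ?_
    rw [← Finset.mul_sum, sum_dvd_mul_indicator _ hq]
    exact (Finset.prod_dvd_prod_of_subset _ _ _ (Finset.mem_powerset.1 hT)).trans
      (Nat.prod_primeFactors_dvd q)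
  have e2 : N * meanAbsRamanujan q = q.totient *
      ∑ T ∈ q.primeFactors.powerset, subsetWeight q.primeFactors T *
        (N / (q / ∏ p ∈ T, (p : ℝ))) := by
    rw [meanAbsRamanujan_apply, ← sum_subsetWeight_mul_prod hP, Finset.sum_mul, Finset.sum_div,
      Finset.mul_sum, Finset.mul_sum]
    refine Finset.sum_congr rfl fun T hT => ?_
    rw [div_div_eq_mul_div]
    ring
  rw [e1, e2, ← mul_sub, ← Finset.sum_sub_distrib, abs_mul, Nat.abs_cast]
  refine mul_le_of_le_one_right (Nat.cast_nonneg _) ?_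
  refine (Finset.abs_sum_le_sum_abs _ _).trans ?_
  rw [← sum_subsetWeight hP]
  refine Finset.sum_le_sum fun T hT => ?_
  have hd : ∏ p ∈ T, p ∣ q :=
    (Finset.prod_dvd_prod_of_subset _ _ _ (Finset.mem_powerset.1 hT)).trans
      (Nat.prod_primeFactors_dvd q)
  have h0 : ∏ p ∈ T, p ≠ 0 := fun h => hq (by simpa [h] using hd)
  rw [← mul_sub, abs_mul, abs_of_nonneg (subsetWeight_nonneg hP (Finset.mem_powerset.1 hT))]
  refine mul_le_of_le_one_right (subsetWeight_nonneg hP (Finset.mem_powerset.1 hT)) ?_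
  rw [← Nat.cast_prod, ← Nat.cast_div hd (mod_cast h0), ← Nat.floor_div_eq_div (K := ℝ)]
  have h1 := Nat.floor_le (show 0 ≤ (N : ℝ) / ((q / ∏ p ∈ T, p : ℕ) : ℝ) by positivity)
  have h2 := Nat.lt_floor_add_one ((N : ℝ) / ((q / ∏ p ∈ T, p : ℕ) : ℝ))
  rw [abs_le]
  constructor <;> linarith

/-! ### Factoring out the divisor function: local factors and Euler product. -/

lemma ArithmeticFunction.mul_moebius_apply_prime_pow_succ (f : ArithmeticFunction ℝ) {p : ℕ}
    (hp : p.Prime) (k : ℕ) :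
    (f * (ArithmeticFunction.moebius : ArithmeticFunction ℝ)) (p ^ (k + 1)) =
      f (p ^ (k + 1)) - f (p ^ k) := by
  have h : f * (ArithmeticFunction.moebius : ArithmeticFunction ℝ) *
      (ArithmeticFunction.zeta : ArithmeticFunction ℝ) = f := by
    rw [mul_assoc, ArithmeticFunction.coe_moebius_mul_coe_zeta, mul_one]
  have h' (j : ℕ) : f (p ^ j) = ∑ i ∈ Finset.range (j + 1),
      (f * (ArithmeticFunction.moebius : ArithmeticFunction ℝ)) (p ^ i) := by
    conv_lhs => rw [← h]
    rw [ArithmeticFunction.coe_mul_zeta_apply, Nat.sum_divisors_prime_pow hp]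
  rw [h' (k + 1), h' k, Finset.sum_range_succ _ (k + 1)]
  ring

lemma isMultiplicative_meanAbsRamanujan : meanAbsRamanujan.IsMultiplicative := by
  refine ⟨by simp [meanAbsRamanujan_apply], fun {m n} h => ?_⟩
  simp only [meanAbsRamanujan_apply, h.primeFactors_mul, Nat.totient_mul h,
    Finset.card_union_of_disjoint h.disjoint_primeFactors, pow_add, Nat.cast_mul]
  ring

/-- The Dirichlet convolution of `meanAbsRamanujan` with the inverse of the divisor function. -/
noncomputable def meanCoeff : ArithmeticFunction ℝ :=
  meanAbsRamanujan * (ArithmeticFunction.moebius : ArithmeticFunction ℝ) *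
    (ArithmeticFunction.moebius : ArithmeticFunction ℝ)

lemma isMultiplicative_meanCoeff : meanCoeff.IsMultiplicative :=
  (isMultiplicative_meanAbsRamanujan.mul ArithmeticFunction.isMultiplicative_moebius.intCast).mul
    ArithmeticFunction.isMultiplicative_moebius.intCast

lemma meanAbsRamanujan_eq_mul : meanAbsRamanujan = meanCoeff *
    ((ArithmeticFunction.zeta : ArithmeticFunction ℝ) *
      (ArithmeticFunction.zeta : ArithmeticFunction ℝ)) := by
  rw [meanCoeff, mul_assoc, ← mul_assoc _ (ArithmeticFunction.zeta : ArithmeticFunction ℝ),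
    ArithmeticFunction.coe_moebius_mul_coe_zeta, one_mul, mul_assoc,
    ArithmeticFunction.coe_moebius_mul_coe_zeta, mul_one]

lemma meanAbsRamanujan_prime_pow_succ {p : ℕ} (hp : p.Prime) (k : ℕ) :
    meanAbsRamanujan (p ^ (k + 1)) = 2 * (1 - 1 / (p : ℝ)) := by
  have : (p : ℝ) ≠ 0 := mod_cast hp.ne_zero
  rw [meanAbsRamanujan_apply, Nat.primeFactors_prime_pow k.succ_ne_zero hp,
    Nat.totient_prime_pow_succ hp, Finset.card_singleton, Nat.cast_mul,
    Nat.cast_sub hp.one_le]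
  push_cast
  field_simp
  ring

lemma meanCoeff_prime {p : ℕ} (hp : p.Prime) : meanCoeff p = -2 / (p : ℝ) := by
  have h0 := meanAbsRamanujan_prime_pow_succ hp 0
  have h := ArithmeticFunction.mul_moebius_apply_prime_pow_succ (meanAbsRamanujan *
    (ArithmeticFunction.moebius : ArithmeticFunction ℝ)) hp 0
  have h1 := ArithmeticFunction.mul_moebius_apply_prime_pow_succ meanAbsRamanujan hp 0
  rw [h1, h0, pow_zero,
    (isMultiplicative_meanAbsRamanujan.mul ArithmeticFunction.isMultiplicative_moebius.intCast).1,
    isMultiplicative_meanAbsRamanujan.1, zero_add, pow_one] at h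
  rw [meanCoeff, h]
  ring

lemma meanCoeff_prime_sq {p : ℕ} (hp : p.Prime) : meanCoeff (p ^ 2) = -(1 - 2 / (p : ℝ)) := by
  rw [meanCoeff, ArithmeticFunction.mul_moebius_apply_prime_pow_succ _ hp 1,
    ArithmeticFunction.mul_moebius_apply_prime_pow_succ _ hp 1,
    ArithmeticFunction.mul_moebius_apply_prime_pow_succ _ hp 0,
    meanAbsRamanujan_prime_pow_succ hp, meanAbsRamanujan_prime_pow_succ hp, pow_zero,
    isMultiplicative_meanAbsRamanujan.1]
  ring

/-- The mean is constant on `p ^ k` for `k ≥ 1`, so its second difference vanishes from `k = 3` on.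
-/
lemma meanCoeff_prime_pow_eq_zero {p : ℕ} (hp : p.Prime) {k : ℕ} (hk : 3 ≤ k) :
    meanCoeff (p ^ k) = 0 := by
  obtain ⟨k, rfl⟩ := Nat.exists_eq_add_of_le' hk
  rw [meanCoeff, ArithmeticFunction.mul_moebius_apply_prime_pow_succ _ hp,
    ArithmeticFunction.mul_moebius_apply_prime_pow_succ _ hp,
    ArithmeticFunction.mul_moebius_apply_prime_pow_succ _ hp,
    meanAbsRamanujan_prime_pow_succ hp, meanAbsRamanujan_prime_pow_succ hp,
    meanAbsRamanujan_prime_pow_succ hp]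
  ring

lemma hasSum_meanCoeff_prime_pow {p : ℕ} (hp : p.Prime) :
    HasSum (fun k => meanCoeff (p ^ k) / ((p ^ k : ℕ) : ℝ))
      (1 - 3 / (p : ℝ) ^ 2 + 2 / (p : ℝ) ^ 3) := by
  have hp0 : (p : ℝ) ≠ 0 := mod_cast hp.ne_zero
  have h : ∀ k ∉ Finset.range 3, meanCoeff (p ^ k) / ((p ^ k : ℕ) : ℝ) = 0 := fun k hk => by
    rw [meanCoeff_prime_pow_eq_zero hp (by simpa using hk), zero_div]
  have h' := hasSum_sum_of_ne_finset_zero (L := SummationFilter.unconditional ℕ) h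
  convert h' using 1
  simp only [Finset.sum_range_succ, Finset.sum_range_zero, pow_zero, pow_one,
    isMultiplicative_meanCoeff.1, meanCoeff_prime hp, meanCoeff_prime_sq hp]
  push_cast
  field_simp
  ring

lemma hasSum_abs_meanCoeff_prime_pow {p : ℕ} (hp : p.Prime) :
    HasSum (fun k => |meanCoeff (p ^ k)| / ((p ^ k : ℕ) : ℝ))
      (1 + 3 / (p : ℝ) ^ 2 - 2 / (p : ℝ) ^ 3) := by
  have hp0 : (p : ℝ) ≠ 0 := mod_cast hp.ne_zero
  have hp2 : (2 : ℝ) ≤ p := mod_cast hp.two_le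
  have h1 : |meanCoeff p| = 2 / p := by
    rw [meanCoeff_prime hp, neg_div, abs_neg, abs_of_nonneg (by positivity)]
  have h2 : |meanCoeff (p ^ 2)| = 1 - 2 / p := by
    rw [meanCoeff_prime_sq hp, abs_neg, abs_of_nonneg]
    rw [sub_nonneg, div_le_one (by linarith)]
    exact hp2
  have h : ∀ k ∉ Finset.range 3, |meanCoeff (p ^ k)| / ((p ^ k : ℕ) : ℝ) = 0 := fun k hk => by
    rw [meanCoeff_prime_pow_eq_zero hp (by simpa using hk), abs_zero, zero_div]
  have h' := hasSum_sum_of_ne_finset_zero (L := SummationFilter.unconditional ℕ) h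
  convert h' using 1
  simp only [Finset.sum_range_succ, Finset.sum_range_zero, pow_zero, pow_one,
    isMultiplicative_meanCoeff.1, h1, h2]
  push_cast
  field_simp
  norm_num
  ring

lemma summable_abs_meanCoeff_div : Summable fun n : ℕ => |meanCoeff n| / (n : ℝ) := by
  have hs : Summable fun p : ℕ => 3 / (p : ℝ) ^ 2 := by
    simpa [div_eq_mul_inv] using (Real.summable_nat_pow_inv.2 one_lt_two).mul_left 3
  have h1 : (fun n : ℕ => |meanCoeff n| / (n : ℝ)) 1 = 1 := by
    simp [isMultiplicative_meanCoeff.1]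
  have hmul {m n : ℕ} (h : m.Coprime n) : (fun n : ℕ => |meanCoeff n| / (n : ℝ)) (m * n) =
      (fun n : ℕ => |meanCoeff n| / (n : ℝ)) m * (fun n : ℕ => |meanCoeff n| / (n : ℝ)) n := by
    simp only [isMultiplicative_meanCoeff.2 h, abs_mul, Nat.cast_mul, mul_div_mul_comm]
  have h0 (n : ℕ) : 0 ≤ |meanCoeff n| / (n : ℝ) := by positivity
  have hnorm (n : ℕ) : ‖|meanCoeff n| / (n : ℝ)‖ = |meanCoeff n| / (n : ℝ) :=
    Real.norm_of_nonneg (h0 n)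
  -- Partial sums are bounded by finite Euler products, whose factors are at most `1 + 3 / p ^ 2 ≤
  -- exp (3 / p ^ 2)`.
  refine summable_of_sum_range_le (c := Real.exp (∑' p : ℕ, 3 / (p : ℝ) ^ 2)) h0 fun N => ?_
  obtain ⟨hS, hH⟩ := EulerProduct.summable_and_hasSum_smoothNumbers_prod_primesBelow_tsum
    (f := fun n : ℕ => |meanCoeff n| / (n : ℝ)) h1 hmul
    (fun hp => by simpa only [hnorm] using (hasSum_abs_meanCoeff_prime_pow hp).summable) N
  calc ∑ n ∈ Finset.range N, |meanCoeff n| / (n : ℝ)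
      ≤ ∑ n ∈ Finset.range N with n ∈ N.smoothNumbers, |meanCoeff n| / (n : ℝ) := by
        rw [Finset.sum_filter]
        refine Finset.sum_le_sum fun n hn => ?_
        rcases n.eq_zero_or_pos with rfl | hn0
        · simp
        · rw [if_pos (Nat.mem_smoothNumbers_of_lt hn0 (Finset.mem_range.1 hn))]
    _ = ∑ n ∈ (Finset.range N).subtype (· ∈ N.smoothNumbers), |meanCoeff n| / (n : ℝ) := by
        rw [Finset.sum_subtype_eq_sum_filter (fun n : ℕ => |meanCoeff n| / (n : ℝ))]
    _ ≤ ∏ p ∈ N.primesBelow, ∑' k : ℕ, |meanCoeff (p ^ k)| / ((p ^ k : ℕ) : ℝ) :=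
        sum_le_hasSum _ (fun n _ => h0 n) hH
    _ ≤ ∏ p ∈ N.primesBelow, Real.exp (3 / (p : ℝ) ^ 2) := by
        refine Finset.prod_le_prod (fun p _ => tsum_nonneg fun k => h0 _) fun p hp => ?_
        rw [(hasSum_abs_meanCoeff_prime_pow (Nat.prime_of_mem_primesBelow hp)).tsum_eq]
        have := Real.add_one_le_exp (3 / (p : ℝ) ^ 2)
        have : 0 ≤ 2 / (p : ℝ) ^ 3 := by positivity
        linarith
    _ ≤ Real.exp (∑' p : ℕ, 3 / (p : ℝ) ^ 2) := by
        rw [← Real.exp_sum]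
        exact Real.exp_le_exp.2 (hs.sum_le_tsum _ fun p _ => by positivity)

lemma hasProd_meanCoeff :
    HasProd (fun p : Nat.Primes => 1 - 3 / (p : ℝ) ^ 2 + 2 / (p : ℝ) ^ 3)
      (∑' n : ℕ, meanCoeff n / (n : ℝ)) := by
  have hmul {m n : ℕ} (h : m.Coprime n) : (fun n : ℕ => meanCoeff n / (n : ℝ)) (m * n) =
      (fun n : ℕ => meanCoeff n / (n : ℝ)) m * (fun n : ℕ => meanCoeff n / (n : ℝ)) n := by
    simp only [isMultiplicative_meanCoeff.2 h, Nat.cast_mul, mul_div_mul_comm]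
  have := EulerProduct.eulerProduct_hasProd (f := fun n : ℕ => meanCoeff n / (n : ℝ))
    (by simp [isMultiplicative_meanCoeff.1]) hmul
    (by simpa [abs_div] using summable_abs_meanCoeff_div) (by simp)
  rw [← show (fun p : Nat.Primes => ∑' k, meanCoeff ((p : ℕ) ^ k) / (((p : ℕ) ^ k : ℕ) : ℝ)) =
      fun p : Nat.Primes => 1 - 3 / (p : ℝ) ^ 2 + 2 / (p : ℝ) ^ 3 from
    funext fun p => (hasSum_meanCoeff_prime_pow p.2).tsum_eq]
  exact this

/-! ### Asymptotics of the divisor sum. -/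

/-- The summatory function `∑_{n ≤ M} d(n) = ∑_{k ≤ M} ⌊M / k⌋` of the divisor function. -/
noncomputable def divisorSummatory (M : ℕ) : ℝ := ∑ k ∈ Finset.Ioc 0 M, ((M / k : ℕ) : ℝ)

lemma harmonic_cast_eq (M : ℕ) : ((harmonic M : ℚ) : ℝ) = ∑ k ∈ Finset.Ioc 0 M, 1 / (k : ℝ) := by
  rw [harmonic_eq_sum_Icc]
  push_cast
  simp only [one_div]
  rfl

lemma divisorSummatory_nonneg (M : ℕ) : 0 ≤ divisorSummatory M :=
  Finset.sum_nonneg fun _ _ => Nat.cast_nonneg _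

lemma divisorSummatory_le (M : ℕ) : divisorSummatory M ≤ M * (1 + Real.log M) := by
  refine le_trans ?_ (mul_le_mul_of_nonneg_left (harmonic_le_one_add_log M) M.cast_nonneg)
  rw [harmonic_cast_eq, Finset.mul_sum]
  refine Finset.sum_le_sum fun k _ => ?_
  rw [mul_one_div]
  exact Nat.cast_div_le

lemma le_divisorSummatory (M : ℕ) : M * Real.log M - M ≤ divisorSummatory M := by
  rcases M.eq_zero_or_pos with rfl | hM
  · simp [divisorSummatory]
  have h1 : Real.log M ≤ harmonic M :=
    (Real.log_le_log (mod_cast hM) (by push_cast; linarith)).trans (log_add_one_le_harmonic M)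
  have h2 : (M : ℝ) * harmonic M - M ≤ divisorSummatory M := by
    have h3 : (M : ℝ) * harmonic M - M = ∑ k ∈ Finset.Ioc 0 M, ((M : ℝ) * (1 / k) - 1) := by
      rw [harmonic_cast_eq, Finset.mul_sum, Finset.sum_sub_distrib]
      simp
    rw [h3]
    refine Finset.sum_le_sum fun k _ => ?_
    rw [mul_one_div, ← Nat.floor_div_eq_div (K := ℝ)]
    linarith [Nat.lt_floor_add_one ((M : ℝ) / k)]
  have := mul_le_mul_of_nonneg_left h1 M.cast_nonneg
  linarith

lemma tendsto_divisorSummatory :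
    Tendsto (fun M : ℕ => divisorSummatory M / (M * Real.log M)) atTop (𝓝 1) := by
  have hlog : Tendsto (fun M : ℕ => Real.log M) atTop atTop :=
    Real.tendsto_log_atTop.comp tendsto_natCast_atTop_atTop
  have hinv : Tendsto (fun M : ℕ => (Real.log M)⁻¹) atTop (𝓝 0) := tendsto_inv_atTop_zero.comp hlog
  have hl : Tendsto (fun M : ℕ => 1 - (Real.log M)⁻¹) atTop (𝓝 1) := by
    simpa using hinv.const_sub 1
  have hu : Tendsto (fun M : ℕ => 1 + (Real.log M)⁻¹) atTop (𝓝 1) := by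
    simpa using hinv.const_add 1
  refine tendsto_of_tendsto_of_tendsto_of_le_of_le' hl hu ?_ ?_
  · filter_upwards [hlog.eventually_gt_atTop 0, eventually_gt_atTop 0] with M h hM
    have hM' : (0 : ℝ) < M := mod_cast hM
    rw [le_div_iff₀ (by positivity)]
    refine le_trans (le_of_eq ?_) (le_divisorSummatory M)
    field_simp
  · filter_upwards [hlog.eventually_gt_atTop 0, eventually_gt_atTop 0] with M h hM
    have hM' : (0 : ℝ) < M := mod_cast hM
    rw [div_le_iff₀ (by positivity)]
    refine (divisorSummatory_le M).trans (le_of_eq ?_)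
    field_simp
    ring

open Asymptotics in
lemma isEquivalent_mul_log_floor :
    (fun x : ℝ => (⌊x⌋₊ : ℝ) * Real.log ⌊x⌋₊) ~[atTop] fun x => x * Real.log x :=
  isEquivalent_nat_floor.mul (isEquivalent_nat_floor.log tendsto_id)

open Asymptotics in
lemma isEquivalent_log_div_const {c : ℝ} (hc : 0 < c) :
    (fun x : ℝ => Real.log (x / c)) ~[atTop] fun x => Real.log x := by
  have h : (fun x : ℝ => Real.log (x / c) - Real.log x) =ᶠ[atTop] fun _ => -Real.log c := by
    filter_upwards [eventually_gt_atTop 0] with x hx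
    rw [Real.log_div hx.ne' hc.ne']
    ring
  refine IsLittleO.isEquivalent (IsLittleO.congr' (f₁ := fun _ => -Real.log c) ?_ h.symm
    EventuallyEq.rfl)
  exact isLittleO_const_left.2 (Or.inr (tendsto_norm_atTop_atTop.comp Real.tendsto_log_atTop))

open Asymptotics in
lemma isEquivalent_divisorSummatory :
    (fun M : ℕ => divisorSummatory M) ~[atTop] fun M => (M : ℝ) * Real.log M := by
  refine (isEquivalent_iff_tendsto_one ?_).2 tendsto_divisorSummatory
  filter_upwards [eventually_gt_atTop 1] with M hM
  have : (1 : ℝ) < M := mod_cast hM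
  exact (mul_pos (by linarith) (Real.log_pos this)).ne'

open Asymptotics in
lemma tendsto_divisorSummatory_div {m : ℕ} (hm : 0 < m) :
    Tendsto (fun N : ℕ => divisorSummatory (N / m) / (N * Real.log N)) atTop
      (𝓝 (1 / (m : ℝ))) := by
  have hm' : (0 : ℝ) < m := mod_cast hm
  have hx : Tendsto (fun N : ℕ => (N : ℝ) / m) atTop atTop :=
    tendsto_natCast_atTop_atTop.atTop_div_const hm'
  have h1 := isEquivalent_divisorSummatory.comp_tendsto
    ((tendsto_nat_floor_atTop (α := ℝ)).comp hx)
  have h2 := isEquivalent_mul_log_floor.comp_tendsto hx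
  have h3 := (isEquivalent_log_div_const hm').comp_tendsto tendsto_natCast_atTop_atTop
  have h4 : (fun N : ℕ => divisorSummatory (N / m)) ~[atTop]
      fun N => (N : ℝ) / m * Real.log N := by
    have h5 : (fun N : ℕ => (N : ℝ) / m * Real.log ((N : ℝ) / m)) ~[atTop]
      fun N => (N : ℝ) / m * Real.log N := IsEquivalent.refl.mul h3
    refine IsEquivalent.trans ?_ ((h1.trans h2).trans h5)
    refine EventuallyEq.isEquivalent (Eventually.of_forall fun N => ?_)
    simp [Nat.floor_div_eq_div]
  have hpos : ∀ᶠ N : ℕ in atTop, 0 < (N : ℝ) ∧ 0 < Real.log N := by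
    filter_upwards [eventually_gt_atTop 1] with N hN
    have : (1 : ℝ) < N := mod_cast hN
    exact ⟨by linarith, Real.log_pos this⟩
  have h6 := (isEquivalent_iff_tendsto_one (by
    filter_upwards [hpos] with N hN
    exact (mul_pos (div_pos hN.1 hm') hN.2).ne')).1 h4
  have h7 := h6.mul_const (1 / (m : ℝ))
  rw [one_mul] at h7
  refine h7.congr' ?_
  filter_upwards [hpos] with N hN
  have := hN.1.ne'
  have := hN.2.ne'
  simp only [Pi.div_apply]
  field_simp

/-! ### Summation over `q`. -/

lemma sum_meanAbsRamanujan_eq (N : ℕ) : ∑ q ∈ Finset.Icc 1 N, meanAbsRamanujan q =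
    ∑' m : ℕ, meanCoeff m * divisorSummatory (N / m) := by
  have hz (M : ℕ) : ∑ n ∈ Finset.Ioc 0 M, ((ArithmeticFunction.zeta : ArithmeticFunction ℝ) *
      (ArithmeticFunction.zeta : ArithmeticFunction ℝ)) n = divisorSummatory M := by
    rw [ArithmeticFunction.sum_Ioc_mul_zeta_eq_sum, divisorSummatory]
    refine Finset.sum_congr rfl fun k hk => ?_
    rw [ArithmeticFunction.natCoe_apply,
      ArithmeticFunction.zeta_apply_ne (Finset.mem_Ioc.1 hk).1.ne', Nat.cast_one, one_mul]
  rw [tsum_eq_sum (s := Finset.Ioc 0 N)]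
  · change ∑ q ∈ Finset.Ioc 0 N, meanAbsRamanujan q = _
    rw [meanAbsRamanujan_eq_mul, ArithmeticFunction.sum_Ioc_mul_eq_sum_sum]
    simp only [hz]
  · intro m hm
    rcases m.eq_zero_or_pos with rfl | hm0
    · simp
    · rw [Nat.div_eq_of_lt (by simpa [hm0] using hm)]
      simp [divisorSummatory]

lemma tendsto_sum_meanAbsRamanujan :
    Tendsto (fun N : ℕ => (∑ q ∈ Finset.Icc 1 N, meanAbsRamanujan q) / (N * Real.log N)) atTop
      (𝓝 (∑' m : ℕ, meanCoeff m / (m : ℝ))) := by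
  simp only [sum_meanAbsRamanujan_eq, ← tsum_div_const]
  -- The 2 comes from `1 + log N ≤ 2 log N`, valid once `log N ≥ 1`.
  refine tendsto_tsum_of_dominated_convergence (summable_abs_meanCoeff_div.mul_left 2)
    (fun m => ?_) ?_
  · rcases m.eq_zero_or_pos with rfl | hm
    · simp
    · simpa [div_eq_mul_inv, mul_assoc] using
        (tendsto_divisorSummatory_div hm).const_mul (meanCoeff m)
  · have hlog : Tendsto (fun M : ℕ => Real.log M) atTop atTop :=
      Real.tendsto_log_atTop.comp tendsto_natCast_atTop_atTop
    filter_upwards [hlog.eventually_ge_atTop 1, eventually_gt_atTop 0] with N hN hN0 m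
    have hN' : (0 : ℝ) < N := mod_cast hN0
    rcases m.eq_zero_or_pos with rfl | hm
    · simp
    have hm' : (0 : ℝ) < m := mod_cast hm
    rw [Real.norm_eq_abs, abs_div, abs_mul, abs_of_nonneg (divisorSummatory_nonneg _),
      abs_of_pos (by positivity : 0 < N * Real.log N), div_le_iff₀ (by positivity)]
    have h1 : divisorSummatory (N / m) ≤ N / m * (2 * Real.log N) := by
      refine (divisorSummatory_le _).trans (mul_le_mul Nat.cast_div_le ?_ ?_ (by positivity))
      · have : Real.log ((N / m : ℕ) : ℝ) ≤ Real.log N := by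
          rcases (N / m).eq_zero_or_pos with h | h
          · rw [h, Nat.cast_zero, Real.log_zero]
            linarith
          · exact Real.log_le_log (mod_cast h) (mod_cast Nat.div_le_self _ _)
        linarith
      · have := Real.log_natCast_nonneg (N / m)
        linarith
    calc |meanCoeff m| * divisorSummatory (N / m)
        ≤ |meanCoeff m| * (N / m * (2 * Real.log N)) := by gcongr
      _ = 2 * (|meanCoeff m| / m) * (N * Real.log N) := by ring

/-! ### The double sum, along integers and then reals. -/

lemma abs_sum_sum_sub_le (N : ℕ) :
    |∑ q ∈ Finset.Icc 1 N, ∑ n ∈ Finset.Icc 1 N, |ramanujanSum q n| -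
      N * ∑ q ∈ Finset.Icc 1 N, meanAbsRamanujan q| ≤ (N : ℝ) ^ 2 := by
  rw [Finset.mul_sum, ← Finset.sum_sub_distrib]
  refine (Finset.abs_sum_le_sum_abs _ _).trans ?_
  calc _ ≤ ∑ q ∈ Finset.Icc 1 N, (N : ℝ) := Finset.sum_le_sum fun q hq => by
        rw [Finset.mem_Icc] at hq
        refine (abs_sum_abs_ramanujanSum_sub_le (Nat.one_le_iff_ne_zero.1 hq.1) N).trans ?_
        exact_mod_cast (Nat.totient_le q).trans hq.2
    _ = (N : ℝ) ^ 2 := by simp [sq]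

lemma tendsto_sum_sum_abs_ramanujanSum_nat :
    Tendsto (fun N : ℕ => (∑ q ∈ Finset.Icc 1 N, ∑ n ∈ Finset.Icc 1 N, |ramanujanSum q n|) /
      ((N : ℝ) ^ 2 * Real.log N)) atTop (𝓝 (∑' m : ℕ, meanCoeff m / (m : ℝ))) := by
  have hlog : Tendsto (fun M : ℕ => Real.log M) atTop atTop :=
    Real.tendsto_log_atTop.comp tendsto_natCast_atTop_atTop
  have hinv : Tendsto (fun M : ℕ => (Real.log M)⁻¹) atTop (𝓝 0) := tendsto_inv_atTop_zero.comp hlog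
  have herr : Tendsto (fun N : ℕ =>
      (∑ q ∈ Finset.Icc 1 N, ∑ n ∈ Finset.Icc 1 N, |ramanujanSum q n| -
        N * ∑ q ∈ Finset.Icc 1 N, meanAbsRamanujan q) / ((N : ℝ) ^ 2 * Real.log N))
      atTop (𝓝 0) := by
    refine squeeze_zero_norm' ?_ hinv
    filter_upwards [hlog.eventually_gt_atTop 0, eventually_gt_atTop 0] with N h hN
    have hN' : (0 : ℝ) < N := mod_cast hN
    rw [Real.norm_eq_abs, abs_div, abs_of_pos (by positivity : 0 < (N : ℝ) ^ 2 * Real.log N),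
      div_le_iff₀ (by positivity)]
    refine (abs_sum_sum_sub_le N).trans (le_of_eq ?_)
    field_simp
  have := herr.add tendsto_sum_meanAbsRamanujan
  rw [zero_add] at this
  refine this.congr' ?_
  filter_upwards [hlog.eventually_gt_atTop 0, eventually_gt_atTop 0] with N h hN
  have hN' : (0 : ℝ) < N := mod_cast hN
  field_simp
  ring

theorem mainTheorem10 :
    Multipliable (fun p : Nat.Primes => 1 - 3 / (p : ℝ) ^ 2 + 2 / (p : ℝ) ^ 3) ∧
    Tendsto
      (fun x : ℝ =>
        (∑ q ∈ Finset.Icc 1 ⌊x⌋₊, ∑ n ∈ Finset.Icc 1 ⌊x⌋₊, |ramanujanSum q n|) /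
          (x ^ 2 * Real.log x))
      atTop
      (𝓝 (∏' p : Nat.Primes, (1 - 3 / (p : ℝ) ^ 2 + 2 / (p : ℝ) ^ 3))) := by
  refine ⟨hasProd_meanCoeff.multipliable, ?_⟩
  rw [hasProd_meanCoeff.tprod_eq]
  have h1 := tendsto_sum_sum_abs_ramanujanSum_nat.comp (tendsto_nat_floor_atTop (α := ℝ))
  -- The double sum depends only on `⌊x⌋₊`, so only the normalisation has to pass from `⌊x⌋₊` to
  -- `x`.
  have heq : Asymptotics.IsEquivalent atTop (fun x : ℝ => (⌊x⌋₊ : ℝ) ^ 2 * Real.log ⌊x⌋₊)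
      fun x => x ^ 2 * Real.log x :=
    (Asymptotics.isEquivalent_nat_floor.pow 2).mul
      (Asymptotics.isEquivalent_nat_floor.log tendsto_id)
  have h2 := (Asymptotics.isEquivalent_iff_tendsto_one (by
    filter_upwards [eventually_gt_atTop 1] with x hx
    exact (mul_pos (by positivity) (Real.log_pos hx)).ne')).1 heq
  have h3 := h1.mul h2
  rw [mul_one] at h3
  refine h3.congr' ?_
  filter_upwards [eventually_ge_atTop 2] with x hx
  have hf : 2 ≤ ⌊x⌋₊ := Nat.le_floor (by exact_mod_cast hx)
  have hf' : (2 : ℝ) ≤ ⌊x⌋₊ := mod_cast hf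
  have hl : Real.log ⌊x⌋₊ ≠ 0 := (Real.log_pos (by linarith)).ne'
  have hl' : (⌊x⌋₊ : ℝ) ^ 2 ≠ 0 := by positivity
  simp only [Function.comp_apply, Pi.div_apply]
  exact div_mul_div_cancel₀ (mul_ne_zero hl' hl)
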